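/- All graphs are finite, simple and undirected. For a graph $G$, let $|G|$ be its number of vertices and $d_G(v)$ the degree of $v$. For a positive integer $m$, let $\sigma_m(G)$ be the minimum of $\sum_{v\in I} d_G(v)$ over all independent sets $I$ of $G$ with exactly $m$ vertices, and $\sigma_m(G)=\infty$ if there is no such set. For a nonempty independent set $I$ of $G$, let $\delta_G(I)=\min_{v\in I} d_G(v)$. A closed trail of a graph $H$ is a subgraph of $H$ formed by the vertices and edges of a closed walk that has at least one edge and repeats no edge (vertices may be repeated). A dominating system of $H$ is a finite set $\mathcal D$ of subgraphs of $H$ such that 1. the members of $\mathcal D$ are pairwise edge-disjoint; 2. every member of $\mathcal D$ is a closed trail or a star with at least three edges; 3. every edge of $H$ that belongs to no member of $\mathcal D$ has at least one end that is a vertex of a closed trail belonging to $\mathcal D$. The cardinality of $\mathcal D$ is its number of members. **Theorem.** Let $k$ be a positive integer, let $H$ be a triangle-free graph, and let $G$ be the line graph of $H$. If $\sigma_{k+1}(G)\ge |G|$ and every nonempty independent set $I$ of $G$ satisfies $|I|\le \delta_G(I)-1$, then $H$ has a dominating system of cardinality at most $k$. -/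

import Mathlib

namespace SimpleGraph

variable {V : Type*}

/-- `σ_k(G)`: the minimum degree sum of an independent set of order `k`, and `⊤` (infinity)
if `G` has no independent set of order `k`. -/
noncomputable def minDegreeSum (G : SimpleGraph V) [G.LocallyFinite] (k : ℕ) : ℕ∞ :=
  ⨅ I : {I : Finset V // G.IsNIndepSet k I}, ((∑ v ∈ I.1, G.degree v : ℕ) : ℕ∞)

/-- `δ_G(I)`: the minimum degree in `G` of the vertices contained in `I`
(`⊤` for the empty set). -/
noncomputable def minDegreeOn (G : SimpleGraph V) [G.LocallyFinite] (I : Finset V) : ℕ∞ :=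
  ⨅ v : {v // v ∈ I}, (G.degree v.1 : ℕ∞)

variable {H : SimpleGraph V}

/-- The subgraph `D` is a closed trail: it consists of the vertices and edges of a closed walk
that has at least one edge and repeats no edge (vertices may be repeated). -/
def Subgraph.IsClosedTrail (D : H.Subgraph) : Prop :=
  ∃ (u : V) (p : H.Walk u u), p.IsCircuit ∧ p.toSubgraph = D

/-- The subgraph `D` is a star with at least three edges, with center `c` and set of leaves `L`. -/
def Subgraph.IsStarThree (D : H.Subgraph) : Prop :=
  ∃ (c : V) (L : Finset V), 3 ≤ L.card ∧ D.verts = insert c (L : Set V) ∧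
    ∀ a b, D.Adj a b ↔ (a = c ∧ b ∈ L) ∨ (b = c ∧ a ∈ L)

/-- `𝒟` is a dominating system of `H`. -/
structure IsDominatingSystem (H : SimpleGraph V) (𝒟 : Finset H.Subgraph) : Prop where
  edgeDisjoint : ∀ D ∈ 𝒟, ∀ D' ∈ 𝒟, D ≠ D' → Disjoint D.edgeSet D'.edgeSet
  closedTrail_or_star : ∀ D ∈ 𝒟, D.IsClosedTrail ∨ D.IsStarThree
  dominates : ∀ e ∈ H.edgeSet, (∀ D ∈ 𝒟, e ∉ D.edgeSet) →
    ∃ D ∈ 𝒟, D.IsClosedTrail ∧ ∃ v ∈ e, v ∈ D.verts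

end SimpleGraph

namespace SimpleGraph

open Finset

variable {V : Type*}

/-! Among the sets of edges of `H` with all degrees even, let `F` cover as many vertices as possible
and, subject to that, have a maximal reachability relation (`IsOptimal`). Each component of `F` with
an edge is a closed trail. If an even set `Z` lives on vertices that are pairwise unreachable or
adjacent in `F`, then passing to the symmetric difference of `F` and `Z` keeps everything connected,
so maximality and triangle-freeness force `Z` to be empty (`IsOptimal.eq_empty`). Hence two vertex
sets induce forests: the uncovered vertices, and the ends of a matching made of uncovered edges and
at most one edge per component of `F`.

The forest of uncovered vertices has a vertex cover `S` saturated by a matching `s ↦ f s` leaving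
`S`. The bound on independent sets, applied to a large matching, gives each `s ∈ S` three neighbors
outside `S` (`IsOptimal.three_le_card`). Stars at `S` and the closed trails then form a dominating
system.

If `S` and the components numbered more than `k` together, the edges `s(s, f s)` and one edge per
component would contain a matching of size `k + 1` whose ends induce a forest. Its degree sum in the
line graph is less than the number of edges of `H` (`IsMatchingSet.sum_card_lt`), contrary to the
hypothesis on `σ`. -/

lemma exists_longest_trail [Fintype V] {G : SimpleGraph V} {P : ∀ u w : V, G.Walk u w → Prop}
    (h : ∃ u w p, p.IsTrail ∧ P u w p) :
    ∃ u w p, p.IsTrail ∧ P u w p ∧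
      ∀ u' w' (p' : G.Walk u' w'), p'.IsTrail → P u' w' p' → p'.length ≤ p.length := by
  classical
  let Q : ℕ → Prop := fun n => ∃ u w, ∃ p : G.Walk u w, p.IsTrail ∧ P u w p ∧ p.length = n
  have hb : ∀ n, Q n → n ≤ Fintype.card (Sym2 V) := by
    rintro n ⟨u, w, p, hp, -, rfl⟩
    rw [← Walk.length_edges]
    exact hp.edges_nodup.length_le_card
  obtain ⟨u, w, p, hp, hP⟩ := h
  have hQ : Q (Nat.findGreatest Q (Fintype.card (Sym2 V))) :=
    Nat.findGreatest_spec (hb _ ⟨u, w, p, hp, hP, rfl⟩) ⟨u, w, p, hp, hP, rfl⟩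
  obtain ⟨u₁, w₁, p₁, hp₁, hP₁, hl⟩ := hQ
  refine ⟨u₁, w₁, p₁, hp₁, hP₁, fun u' w' p' hp' hP' => ?_⟩
  have hq : Q p'.length := ⟨u', w', p', hp', hP', rfl⟩
  rw [hl]
  exact Nat.le_findGreatest (hb _ hq) hq

/-! ### Even edge sets and their closed trails -/

/-- Every vertex lies on an even number of edges of `F`. -/
def IsEvenSet [DecidableEq V] (F : Finset (Sym2 V)) : Prop :=
  ∀ v, Even #{e ∈ F | v ∈ e}

/-- The spanning graph with edge set `F`. -/
abbrev edgeGraph (F : Finset (Sym2 V)) : SimpleGraph V := fromEdgeSet (F : Set (Sym2 V))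

lemma edgeGraph_adj_of_mem {H : SimpleGraph V} {F : Finset (Sym2 V)}
    (hF : ∀ e ∈ F, e ∈ H.edgeSet) {a b : V} (h : s(a, b) ∈ F) : (edgeGraph F).Adj a b :=
  (fromEdgeSet_adj _).2 ⟨h, H.ne_of_adj (hF _ h)⟩

lemma edgeGraph_le {H : SimpleGraph V} {F : Finset (Sym2 V)}
    (hF : ∀ e ∈ F, e ∈ H.edgeSet) : edgeGraph F ≤ H :=
  fun _ _ h => hF _ ((fromEdgeSet_adj _).1 h).1

lemma mem_of_mem_edges_edgeGraph {F : Finset (Sym2 V)} {u w : V} {p : (edgeGraph F).Walk u w}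
    {e : Sym2 V} (he : e ∈ p.edges) : e ∈ F := by
  have := p.edges_subset_edgeSet he
  rw [edgeSet_fromEdgeSet] at this
  exact this.1

/-- The trail uses all `F`-edges at its end `w`, and a trail has an odd number of edges at `w`
exactly when `w` is only one of its two ends. -/
lemma even_card_filter_iff_of_exhausted [DecidableEq V] {F : Finset (Sym2 V)} {u w : V}
    {p : (edgeGraph F).Walk u w} (hp : p.IsTrail) (h : ∀ e ∈ F, w ∈ e → e ∈ p.edges) :
    Even #{e ∈ F | w ∈ e} ↔ u = w := by
  have h1 := hp.even_countP_edges_iff w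
  have h2 : p.edges.countP (fun e => w ∈ e) = #{e ∈ F | w ∈ e} := by
    rw [List.countP_eq_length_filter, ← List.toFinset_card_of_nodup (hp.edges_nodup.filter _)]
    congr 1
    ext e
    simp only [List.mem_toFinset, List.mem_filter, decide_eq_true_eq, mem_filter]
    exact ⟨fun h => ⟨mem_of_mem_edges_edgeGraph h.1, h.2⟩, fun hh => ⟨h e hh.1 hh.2, hh.2⟩⟩
  rw [h2] at h1
  rw [h1]
  tauto

/-- A trail that is not exhausted at its end can be extended. -/
lemma exists_trail_extension {H : SimpleGraph V} {F : Finset (Sym2 V)}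
    (hF : ∀ e ∈ F, e ∈ H.edgeSet) {u w : V}
    {p : (edgeGraph F).Walk u w} (hp : p.IsTrail) (h : ¬ ∀ e ∈ F, w ∈ e → e ∈ p.edges) :
    ∃ x, ∃ q : (edgeGraph F).Walk u x, q.IsTrail ∧ q.length = p.length + 1 := by
  push Not at h
  obtain ⟨e, he, hw, hne⟩ := h
  obtain ⟨x, rfl⟩ := Sym2.mem_iff_exists.1 hw
  have hadj := edgeGraph_adj_of_mem hF he
  refine ⟨x, p.concat hadj, ?_, by simp⟩
  rw [Walk.isTrail_def, Walk.edges_concat, List.concat_eq_append, List.nodup_append]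
  refine ⟨hp.edges_nodup, by simp, ?_⟩
  rintro a ha b hb rfl
  simp only [List.mem_singleton] at hb
  exact hne (hb ▸ ha)

/-- An even graph has no bridge: without `s(a, b)` only `a` and `b` have odd degree, so a longest
trail from `b` must get stuck at `a`. -/
lemma IsEvenSet.reachable_erase [Fintype V] [DecidableEq V] {H : SimpleGraph V}
    {F : Finset (Sym2 V)} (hE : IsEvenSet F)
    (hF : ∀ e ∈ F, e ∈ H.edgeSet) {a b : V} (hab : s(a, b) ∈ F) :
    (edgeGraph (F.erase s(a, b))).Reachable b a := by
  have hF' : ∀ e ∈ F.erase s(a, b), e ∈ H.edgeSet := fun e he => hF e (mem_of_mem_erase he)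
  obtain ⟨u, w, p, hp, rfl, hmax⟩ := exists_longest_trail (G := edgeGraph (F.erase s(a, b)))
    (P := fun u w p => u = b) ⟨b, b, .nil, by simp, rfl⟩
  have hex : ∀ e ∈ F.erase s(a, u), w ∈ e → e ∈ p.edges := by
    by_contra h
    obtain ⟨x, q, hq, hl⟩ := exists_trail_extension hF' hp h
    have := hmax _ _ q hq rfl
    omega
  have hpar := even_card_filter_iff_of_exhausted hp hex
  have key : ∀ v, v ∈ s(a, u) → ¬ Even #{e ∈ F.erase s(a, u) | v ∈ e} := by
    intro v hv hev
    have h1 := hE v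
    rw [filter_erase, card_erase_of_mem (by simp [hab, hv])] at hev
    have h2 : 0 < #{e ∈ F | v ∈ e} := card_pos.2 ⟨s(a, u), by simp [hab, hv]⟩
    rw [Nat.even_sub (by omega)] at hev
    simp [h1] at hev
  by_cases hwa : w = a
  · exact hwa ▸ p.reachable
  · exfalso
    by_cases hwu : u = w
    · exact key w (by simp [hwu]) (hpar.2 hwu)
    · apply hwu
      rw [← hpar]
      have : w ∉ s(a, u) := by simp [hwa, Ne.symm hwu]
      rw [filter_erase, erase_eq_of_notMem (by simp [this])]
      exact hE w

/-- Euler's argument: a longest trail in the component of `a` is closed by parity. An unused edge at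
one of its vertices could be put in front of the trail rotated to start there, making it longer. -/
lemma IsEvenSet.exists_isCircuit [Fintype V] [DecidableEq V] {H : SimpleGraph V}
    {F : Finset (Sym2 V)} (hE : IsEvenSet F)
    (hF : ∀ e ∈ F, e ∈ H.edgeSet) {a b : V} (hab : s(a, b) ∈ F) :
    ∃ u, ∃ p : H.Walk u u, p.IsCircuit ∧
      ∀ e, e ∈ p.edges ↔ e ∈ F ∧ ∃ x ∈ e, (edgeGraph F).Reachable a x := by
  have hadj := edgeGraph_adj_of_mem hF hab
  obtain ⟨u, w, p, hp, hau, hmax⟩ := exists_longest_trail (G := edgeGraph F)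
    (P := fun u w p => (edgeGraph F).Reachable a u)
    ⟨a, b, .cons hadj .nil, by simp, .refl _⟩
  have hlen : 1 ≤ p.length := hmax _ _ (.cons hadj .nil) (by simp) (.refl _)
  have hex : ∀ e ∈ F, w ∈ e → e ∈ p.edges := by
    by_contra h
    obtain ⟨x, q, hq, hl⟩ := exists_trail_extension hF hp h
    have := hmax _ _ q hq hau
    omega
  obtain rfl : u = w := (even_card_filter_iff_of_exhausted hp hex).1 (hE w)
  have hsupp : ∀ x ∈ p.support, ∀ e ∈ F, x ∈ e → e ∈ p.edges := by
    intro x hx e he hxe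
    by_contra hne
    obtain ⟨y, rfl⟩ := Sym2.mem_iff_exists.1 hxe
    have hxy := edgeGraph_adj_of_mem hF he
    have hrot := p.rotate_edges x hx
    have h1 := hmax _ _ (.cons hxy.symm (p.rotate x hx)) (by
      rw [Walk.isTrail_cons]
      refine ⟨hp.rotate hx, fun h => hne ?_⟩
      rw [Sym2.eq_swap]
      exact hrot.mem_iff.1 h) (hau.trans ((p.takeUntil x hx).reachable.trans hxy.reachable))
    have h2 := hrot.perm.length_eq
    simp only [Walk.length_edges, Walk.length_cons] at h1 h2
    omega
  have hreach : ∀ x, (edgeGraph F).Reachable u x → x ∈ p.support := by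
    rintro x ⟨q⟩
    have : ∀ {s t : V} (q : (edgeGraph F).Walk s t), s ∈ p.support → t ∈ p.support := by
      intro s t q
      induction q with
      | nil => exact id
      | cons h q ih =>
        intro hs
        exact ih (p.snd_mem_support_of_mem_edges
          (hsupp _ hs _ ((fromEdgeSet_adj _).1 h).1 (Sym2.mem_mk_left _ _)))
    exact this q p.start_mem_support
  refine ⟨u, p.mapLe (edgeGraph_le hF), ?_, fun e => ?_⟩
  · rw [Walk.isCircuit_mapLe]
    refine ⟨hp, ?_⟩
    rintro rfl
    simp at hlen
  · rw [Walk.edges_mapLe_eq_edges]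
    constructor
    · intro he
      refine ⟨mem_of_mem_edges_edgeGraph he, ?_⟩
      induction e with | _ x y =>
      exact ⟨x, by simp, hau.trans (p.takeUntil x (p.fst_mem_support_of_mem_edges he)).reachable⟩
    · rintro ⟨he, x, hx, hax⟩
      exact hsupp x (hreach x (hau.symm.trans hax)) e he hx

lemma CliqueFree.not_adj_of_adj_adj {H : SimpleGraph V} (hH : H.CliqueFree 3) {a b c : V}
    (hab : H.Adj a b) (hbc : H.Adj b c) : ¬ H.Adj a c := by
  classical
  exact fun hac => hH {a, b, c} (is3Clique_triple_iff.2 ⟨hab, hac, hbc⟩)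

lemma IsEvenSet.symmDiff [DecidableEq V] {A B : Finset (Sym2 V)} (hA : IsEvenSet A)
    (hB : IsEvenSet B) : IsEvenSet (_root_.symmDiff A B) := by
  intro v
  have h : #{e ∈ _root_.symmDiff A B | v ∈ e} + 2 * #(A.filter (v ∈ ·) ∩ B.filter (v ∈ ·))
      = #{e ∈ A | v ∈ e} + #{e ∈ B | v ∈ e} := by
    have h0 : {e ∈ _root_.symmDiff A B | v ∈ e} = (A.filter (v ∈ ·) \ B.filter (v ∈ ·)) ∪
        (B.filter (v ∈ ·) \ A.filter (v ∈ ·)) := by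
      ext; simp only [mem_symmDiff, mem_sdiff, mem_union, mem_filter]; tauto
    rw [h0, card_union_of_disjoint disjoint_sdiff_sdiff]
    have h1 := card_sdiff_add_card_inter (A.filter (v ∈ ·)) (B.filter (v ∈ ·))
    have h2 := card_sdiff_add_card_inter (B.filter (v ∈ ·)) (A.filter (v ∈ ·))
    rw [inter_comm] at h2
    omega
  have h1 : Even (#{e ∈ _root_.symmDiff A B | v ∈ e} +
      2 * #(A.filter (v ∈ ·) ∩ B.filter (v ∈ ·))) :=
    h ▸ (hA v).add (hB v)
  rw [Nat.even_add] at h1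
  exact h1.2 (even_two_mul _)

lemma Walk.IsTrail.isEvenSet_edges [DecidableEq V] {G : SimpleGraph V} {u : V} {p : G.Walk u u}
    (hp : p.IsTrail) : IsEvenSet p.edges.toFinset := by
  intro v
  have h := (hp.even_countP_edges_iff v).2 (fun h => absurd rfl h)
  simpa [List.countP_eq_length_filter, ← List.toFinset_card_of_nodup (hp.edges_nodup.filter _),
    List.toFinset_filter] using h

/-! ### Optimal even sets and the exchange argument -/

/-- The vertices lying on an edge of `F`. -/
def covered [Fintype V] [DecidableEq V] (F : Finset (Sym2 V)) : Finset V :=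
  {v | ∃ e ∈ F, v ∈ e}

lemma mem_covered [Fintype V] [DecidableEq V] {F : Finset (Sym2 V)} {v : V} :
    v ∈ covered F ↔ ∃ e ∈ F, v ∈ e := by
  simp [covered]

lemma mem_covered_of_reachable [Fintype V] [DecidableEq V] {F : Finset (Sym2 V)} {v w : V}
    (h : (edgeGraph F).Reachable v w) (hne : v ≠ w) : v ∈ covered F := by
  obtain ⟨p⟩ := h
  cases p with
  | nil => exact absurd rfl hne
  | cons h p => exact mem_covered.2 ⟨_, ((fromEdgeSet_adj _).1 h).1, Sym2.mem_mk_left _ _⟩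

/-- An even set of edges of `H` covering as many vertices as possible and, subject to that, with
a maximal reachability relation. -/
structure IsOptimal [Fintype V] [DecidableEq V] (H : SimpleGraph V) (F : Finset (Sym2 V)) :
    Prop where
  sub : ∀ e ∈ F, e ∈ H.edgeSet
  even : IsEvenSet F
  card_covered_le : ∀ F' : Finset (Sym2 V), (∀ e ∈ F', e ∈ H.edgeSet) → IsEvenSet F' →
    #(covered F') ≤ #(covered F)
  reachable_of_le : ∀ F' : Finset (Sym2 V), (∀ e ∈ F', e ∈ H.edgeSet) → IsEvenSet F' →
    (∀ a b, (edgeGraph F).Reachable a b → (edgeGraph F').Reachable a b) →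
    ∀ a b, (edgeGraph F').Reachable a b → (edgeGraph F).Reachable a b

lemma exists_isOptimal [Fintype V] [DecidableEq V] (H : SimpleGraph V) :
    ∃ F, IsOptimal H F := by
  classical
  let R : Finset (Sym2 V) → Finset (V × V) := fun F => {x | (edgeGraph F).Reachable x.1 x.2}
  let c := Fintype.card (V × V)
  have hR : ∀ F, #(R F) ≤ c := fun F => card_le_univ _
  -- The weight encodes the lexicographic order: the factor `c + 1` exceeds every possible value of
  -- `#(R F)`.
  obtain ⟨F, hF, hmax⟩ := exists_max_image
    (univ.filter fun F : Finset (Sym2 V) => (∀ e ∈ F, e ∈ H.edgeSet) ∧ IsEvenSet F)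
    (fun F => #(covered F) * (c + 1) + #(R F)) ⟨∅, mem_filter.2 ⟨mem_univ _, by simp, fun v => by simp⟩⟩
  simp only [mem_filter, mem_univ, true_and] at hF hmax
  refine ⟨F, hF.1, hF.2, fun F' h1 h2 => ?_, fun F' h1 h2 hle a b hab => ?_⟩
  · have h3 := hmax F' ⟨h1, h2⟩
    have h4 := hR F
    by_contra! h5
    have : (#(covered F) + 1) * (c + 1) ≤ #(covered F') * (c + 1) := Nat.mul_le_mul_right _ h5
    rw [add_mul] at this
    omega
  · have h3 := hmax F' ⟨h1, h2⟩
    have hsub : R F ⊆ R F' := fun x hx => by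
      simp only [R, mem_filter, mem_univ, true_and] at hx ⊢
      exact hle _ _ hx
    have hcov : covered F ⊆ covered F' := by
      intro v hv
      obtain ⟨e, he, hve⟩ := mem_covered.1 hv
      obtain ⟨w, rfl⟩ := Sym2.mem_iff_exists.1 hve
      have hadj := edgeGraph_adj_of_mem hF.1 he
      exact mem_covered_of_reachable (hle _ _ hadj.reachable) hadj.ne
    have h4 : #(covered F) * (c + 1) ≤ #(covered F') * (c + 1) :=
      Nat.mul_le_mul_right _ (card_le_card hcov)
    have h5 := eq_of_subset_of_card_le hsub (by omega)
    have h6 : (a, b) ∈ R F' := by simpa [R] using hab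
    rw [← h5] at h6
    simpa [R] using h6

/-- An optimal even set admits no improvement along an even set `Z` whose vertices are pairwise
unreachable or adjacent in `F`. -/
lemma IsOptimal.eq_empty [Fintype V] [DecidableEq V] {H : SimpleGraph V} {F : Finset (Sym2 V)}
    (hF : IsOptimal H F) (hH : H.CliqueFree 3) {A : Finset V}
    (hA : ∀ a ∈ A, ∀ b ∈ A, (edgeGraph F).Reachable a b → a = b ∨ s(a, b) ∈ F)
    {Z : Finset (Sym2 V)} (hZH : ∀ e ∈ Z, e ∈ H.edgeSet) (hZ : IsEvenSet Z)
    (hZA : ∀ e ∈ Z, ∀ v ∈ e, v ∈ A) : Z = ∅ := by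
  -- Three distinct mutually reachable vertices of `A` would form a triangle.
  have htri : ∀ a ∈ A, ∀ b ∈ A, ∀ c ∈ A, (edgeGraph F).Reachable a b →
      (edgeGraph F).Reachable b c → a = b ∨ b = c ∨ a = c := by
    intro a ha b hb c hc hab hbc
    by_contra! hne
    have h1 := (hA a ha b hb hab).resolve_left hne.1
    have h2 := (hA b hb c hc hbc).resolve_left hne.2.1
    have h3 := (hA a ha c hc (hab.trans hbc)).resolve_left hne.2.2
    exact hH.not_adj_of_adj_adj (hF.sub _ h1) (hF.sub _ h2) (hF.sub _ h3)
  have hsub : ∀ e ∈ symmDiff F Z, e ∈ H.edgeSet := by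
    intro e he
    rcases mem_symmDiff.1 he with h | h
    exacts [hF.sub e h.1, hZH e h.1]
  -- If `s(a, b)` is lost to `Z`, a walk in `F` avoiding it still joins its ends. That walk
  -- survives: a `Z`-edge on it would have both ends in `A` and reachable from `a`, so by `htri` it
  -- would be `s(a, b)` itself.
  have hedge : ∀ a b, s(a, b) ∈ F → (edgeGraph (symmDiff F Z)).Reachable a b := by
    intro a b hab
    by_cases hz : s(a, b) ∈ Z
    · obtain ⟨p⟩ := hF.even.reachable_erase hF.sub hab
      refine (Reachable.symm ⟨p.transfer _ fun e he => ?_⟩)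
      have heF := mem_of_mem_edges_edgeGraph he
      have heF' := mem_of_mem_erase heF
      by_cases heZ : e ∈ Z
      · exfalso
        induction e with | _ x y =>
        have hle : edgeGraph (F.erase s(a, b)) ≤ edgeGraph F :=
          fromEdgeSet_mono (by simp)
        have hxy := edgeGraph_adj_of_mem hF.sub heF'
        have hba := edgeGraph_adj_of_mem hF.sub hab
        have hbx : (edgeGraph F).Reachable b x :=
          (p.takeUntil x (p.fst_mem_support_of_mem_edges he)).reachable.mono hle
        have ha := hZA _ hz a (Sym2.mem_mk_left _ _)
        have hb := hZA _ hz b (Sym2.mem_mk_right _ _)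
        have hx := hZA _ heZ x (Sym2.mem_mk_left _ _)
        have hy := hZA _ heZ y (Sym2.mem_mk_right _ _)
        have h1 := htri a ha b hb x hx hba.reachable hbx
        have h2 := htri a ha b hb y hy hba.reachable (hbx.trans hxy.reachable)
        apply ne_of_mem_erase heF
        rcases h1 with h | rfl | rfl
        · exact absurd h hba.ne
        · rcases h2 with h | h | rfl
          · exact absurd h hba.ne
          · exact absurd h hxy.ne
          · exact Sym2.eq_swap
        · rcases h2 with h | rfl | h
          · exact absurd h hba.ne
          · rfl
          · exact absurd h hxy.ne
      · have : e ∈ symmDiff F Z := mem_symmDiff.2 (.inl ⟨heF', heZ⟩)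
        induction e with | _ x y => exact edgeGraph_adj_of_mem hsub this
    · exact (edgeGraph_adj_of_mem hsub (mem_symmDiff.2 (.inl ⟨hab, hz⟩))).reachable
  have hmono : ∀ a b, (edgeGraph F).Reachable a b →
      (edgeGraph (symmDiff F Z)).Reachable a b := by
    rintro a b ⟨p⟩
    induction p with
    | nil => exact .refl _
    | cons h p ih => exact (hedge _ _ ((fromEdgeSet_adj _).1 h).1).trans ih
  -- By maximality no new connection arises, so every edge of `Z` joins `F`-reachable vertices; two
  -- edges of `Z` at one vertex then contradict `htri`.
  have hback := hF.reachable_of_le _ hsub (hF.even.symmDiff hZ) hmono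
  have hZr : ∀ x y, s(x, y) ∈ Z → (edgeGraph F).Reachable x y := by
    intro x y hxy
    by_cases hf : s(x, y) ∈ F
    · exact (edgeGraph_adj_of_mem hF.sub hf).reachable
    · exact hback _ _
        (edgeGraph_adj_of_mem hsub (mem_symmDiff.2 (.inr ⟨hxy, hf⟩))).reachable
  by_contra hne
  obtain ⟨e, he⟩ := nonempty_iff_ne_empty.2 hne
  induction e with | _ x y =>
  have hpos : 0 < #{e ∈ Z | x ∈ e} := card_pos.2 ⟨s(x, y), by simp [he]⟩
  have h2 : 1 < #{e ∈ Z | x ∈ e} := by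
    obtain ⟨m, hm⟩ := hZ x
    omega
  obtain ⟨e', he', hne'⟩ := exists_mem_ne h2 s(x, y)
  rw [mem_filter] at he'
  obtain ⟨z, rfl⟩ := Sym2.mem_iff_exists.1 he'.2
  have h3 := htri y (hZA _ he y (by simp)) x (hZA _ he x (by simp)) z (hZA _ he'.1 z (by simp))
    (hZr _ _ he).symm (hZr _ _ he'.1)
  rcases h3 with h | h | h
  · exact (H.ne_of_adj (hZH _ he)) h.symm
  · exact (H.ne_of_adj (hZH _ he'.1)) h
  · exact hne' (by rw [h])

/-! ### Forests: leaves, edge count, vertex cover -/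

/-- Every nonempty subset of `A` has a vertex with at most one neighbor in that subset. -/
def HasLeaves (H : SimpleGraph V) [DecidableRel H.Adj] (A : Finset V) : Prop :=
  ∀ B ⊆ A, B.Nonempty → ∃ v ∈ B, #{w ∈ B | H.Adj v w} ≤ 1

/-- The edges of `H` with both ends in `A`. -/
def edgesIn [Fintype V] [DecidableEq V] (H : SimpleGraph V) [DecidableRel H.Adj] (A : Finset V) :
    Finset (Sym2 V) :=
  {e | e ∈ H.edgeSet ∧ ∀ v ∈ e, v ∈ A}

lemma mem_edgesIn [Fintype V] [DecidableEq V] {H : SimpleGraph V} [DecidableRel H.Adj]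
    {A : Finset V} {e : Sym2 V} : e ∈ edgesIn H A ↔ e ∈ H.edgeSet ∧ ∀ v ∈ e, v ∈ A := by
  simp [edgesIn]

/-- The edge set of a cycle is even and nonempty, so the induced graph is acyclic; the end of a
longest path is then adjacent to at most its predecessor. -/
lemma hasLeaves_of_forall_isEvenSet [Fintype V] [DecidableEq V] {H : SimpleGraph V}
    [DecidableRel H.Adj] {A : Finset V}
    (h : ∀ Z : Finset (Sym2 V), (∀ e ∈ Z, e ∈ H.edgeSet) → IsEvenSet Z →
      (∀ e ∈ Z, ∀ v ∈ e, v ∈ A) → Z = ∅) : HasLeaves H A := by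
  intro B hB ⟨v₀, hv₀⟩
  have hacyc : (edgeGraph (edgesIn H B)).IsAcyclic := by
    intro u c hc
    have hZ := h c.edges.toFinset (fun e he => ?_) hc.isTrail.isEvenSet_edges (fun e he v hv => ?_)
    · apply hc.ne_nil
      rw [List.toFinset_eq_empty_iff, Walk.edges_eq_nil] at hZ
      exact hZ.eq_nil
    · exact (mem_edgesIn.1 (mem_of_mem_edges_edgeGraph (List.mem_toFinset.1 he))).1
    · exact hB ((mem_edgesIn.1 (mem_of_mem_edges_edgeGraph (List.mem_toFinset.1 he))).2 v hv)
  have hadj : ∀ a ∈ B, ∀ b ∈ B, H.Adj a b → (edgeGraph (edgesIn H B)).Adj a b := by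
    intro a ha b hb hab
    refine edgeGraph_adj_of_mem (H := H) (fun e he => (mem_edgesIn.1 he).1)
      (mem_edgesIn.2 ⟨hab, ?_⟩)
    simp [ha, hb]
  obtain ⟨u, w, p, -, ⟨hp, hw⟩, hmax⟩ := exists_longest_trail (G := edgeGraph (edgesIn H B))
    (P := fun u w p => p.IsPath ∧ w ∈ B) ⟨v₀, v₀, .nil, by simp, by simp, hv₀⟩
  refine ⟨w, hw, card_le_one.2 ?_⟩
  have key : ∀ x ∈ B, H.Adj w x → x = p.penultimate := by
    intro x hx hwx
    refine hacyc.eq_penultimate_of_adj_end hp (hadj w hw x hx hwx) ?_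
    by_contra hns
    have := hmax _ _ (p.concat (hadj w hw x hx hwx)) (hp.concat hns _).isTrail
      ⟨hp.concat hns _, hx⟩
    simp at this
  simp only [mem_filter]
  exact fun a ha b hb => (key a ha.1 ha.2).trans (key b hb.1 hb.2).symm

lemma HasLeaves.mono {H : SimpleGraph V} [DecidableRel H.Adj] {A B : Finset V}
    (h : HasLeaves H A) (hBA : B ⊆ A) : HasLeaves H B :=
  fun C hC => h C (hC.trans hBA)

lemma HasLeaves.card_edgesIn_lt [Fintype V] [DecidableEq V] {H : SimpleGraph V}
    [DecidableRel H.Adj] {A : Finset V} (h : HasLeaves H A) (hA : A.Nonempty) :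
    #(edgesIn H A) < #A := by
  induction hn : #A generalizing A with
  | zero => simp_all
  | succ n ih =>
    obtain ⟨v, hv, hle⟩ := h A subset_rfl hA
    have hsub : edgesIn H A ⊆ edgesIn H (A.erase v) ∪ image (fun w => s(v, w)) {w ∈ A | H.Adj v w} := by
      intro e he
      rw [mem_edgesIn] at he
      by_cases hve : v ∈ e
      · obtain ⟨w, rfl⟩ := Sym2.mem_iff_exists.1 hve
        refine mem_union_right _ (mem_image.2 ⟨w, mem_filter.2 ⟨he.2 w (by simp), he.1⟩, rfl⟩)
      · refine mem_union_left _ (mem_edgesIn.2 ⟨he.1, fun x hx => mem_erase.2 ⟨?_, he.2 x hx⟩⟩)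
        rintro rfl
        exact hve hx
    have h1 := (card_le_card hsub).trans (card_union_le _ _)
    have h2 : #(image (fun w => s(v, w)) {w ∈ A | H.Adj v w}) ≤ #{w ∈ A | H.Adj v w} :=
      card_image_le
    have hcard : #(A.erase v) = n := by rw [card_erase_of_mem hv]; omega
    rcases (A.erase v).eq_empty_or_nonempty with he | hne
    · have hAv : A = {v} := by
        rw [erase_eq_empty_iff] at he
        exact he.resolve_left hA.ne_empty
      have h3 : edgesIn H (A.erase v) = ∅ := by
        rw [he, eq_empty_iff_forall_notMem]
        intro e he
        induction e with | _ x y => exact absurd ((mem_edgesIn.1 he).2 x (by simp)) (by simp)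
      have h4 : #{w ∈ A | H.Adj v w} = 0 := by rw [hAv]; simp
      rw [h3, card_empty] at h1
      omega
    · have := ih (h.mono (erase_subset _ _)) hne hcard
      omega

/-- A vertex cover of a forest together with a matching saturating it. -/
lemma HasLeaves.exists_cover [DecidableEq V] {H : SimpleGraph V}
    [DecidableRel H.Adj] {W : Finset V} (h : HasLeaves H W) :
    ∃ S ⊆ W, ∃ f : V → V, Set.InjOn f S ∧ (∀ s ∈ S, f s ∈ W ∧ f s ∉ S ∧ H.Adj s (f s)) ∧
      ∀ a ∈ W, ∀ b ∈ W, H.Adj a b → a ∈ S ∨ b ∈ S := by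
  induction W using Finset.strongInduction with
  | H W ih =>
  rcases W.eq_empty_or_nonempty with rfl | hne
  · exact ⟨∅, by simp, id, by simp⟩
  obtain ⟨v, hv, hle⟩ := h W subset_rfl hne
  rcases Nat.le_one_iff_eq_zero_or_eq_one.1 hle with h0 | h1
  · obtain ⟨S, hS, f, hf, hSf, hc⟩ := ih (W.erase v) (erase_ssubset hv) (h.mono (erase_subset _ _))
    rw [card_eq_zero, filter_eq_empty_iff] at h0
    refine ⟨S, hS.trans (erase_subset _ _), f, hf,
      fun s hs => ⟨mem_of_mem_erase (hSf s hs).1, (hSf s hs).2⟩, fun a ha b hb hab => ?_⟩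
    refine hc a (mem_erase.2 ⟨?_, ha⟩) b (mem_erase.2 ⟨?_, hb⟩) hab
    · rintro rfl; exact h0 hb hab
    · rintro rfl; exact h0 ha hab.symm
  -- The leaf `v` has the single neighbor `w`: putting `w` in the cover with partner `v` handles
  -- every edge at `v` or `w`.
  · obtain ⟨w, hw⟩ := card_eq_one.1 h1
    have hvw : w ∈ W ∧ H.Adj v w := by
      rw [← mem_filter, hw]; simp
    have honly : ∀ x ∈ W, H.Adj v x → x = w := by
      intro x hx hvx
      have : x ∈ ({x ∈ W | H.Adj v x} : Finset V) := mem_filter.2 ⟨hx, hvx⟩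
      rwa [hw, mem_singleton] at this
    have hsub : (W.erase v).erase w ⊆ W := (erase_subset _ _).trans (erase_subset _ _)
    obtain ⟨S, hS, f, hf, hSf, hc⟩ := ih ((W.erase v).erase w)
      ((erase_subset _ _).trans_ssubset (erase_ssubset hv)) (h.mono hsub)
    have hwS : w ∉ S := fun hh => by simpa using hS hh
    have hvS : v ∉ S := fun hh => by simpa using hS hh
    have hup : ∀ s ∈ S, Function.update f w v s = f s := fun s hs =>
      Function.update_of_ne (by rintro rfl; exact hwS hs) _ _
    have hfv : ∀ s ∈ S, f s ≠ v := fun s hs hh => by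
      simpa [hh] using (hSf s hs).1
    refine ⟨insert w S, insert_subset hvw.1 (hS.trans hsub), Function.update f w v, ?_, ?_, ?_⟩
    · rw [coe_insert, Set.injOn_insert (by simpa using hwS)]
      refine ⟨fun a ha b hb hab => ?_, ?_⟩
      · rw [hup a ha, hup b hb] at hab
        exact hf ha hb hab
      · rintro ⟨s, hs, hh⟩
        rw [hup s hs, Function.update_self] at hh
        exact hfv s hs hh
    · intro s hs
      rcases mem_insert.1 hs with rfl | hs
      · rw [Function.update_self]
        exact ⟨hv, by simp [hvS, hvw.2.ne], hvw.2.symm⟩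
      · rw [hup s hs]
        refine ⟨hsub (hSf s hs).1, ?_, (hSf s hs).2.2⟩
        rw [mem_insert, not_or]
        exact ⟨fun hh => by simpa [hh] using (hSf s hs).1, (hSf s hs).2.1⟩
    · intro a ha b hb hab
      by_cases haw : a = w
      · simp [haw]
      by_cases hbw : b = w
      · simp [hbw]
      have hav : a ≠ v := by rintro rfl; exact hbw (honly b hb hab)
      have hbv : b ≠ v := by rintro rfl; exact haw (honly a ha hab.symm)
      rcases hc a (by simp [*]) b (by simp [*]) hab with hh | hh <;> simp [hh]

/-! ### Covered neighbors of an uncovered vertex -/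

/-- If an uncovered vertex `v` has two neighbors that are `F`-adjacent to `y`, then `y` has
`F`-degree at most two: otherwise exchanging along a 4-cycle would cover `v` as well. -/
lemma IsOptimal.card_filter_mem_le_two [Fintype V] [DecidableEq V] {H : SimpleGraph V}
    {F : Finset (Sym2 V)} (hF : IsOptimal H F) {v x₁ x₂ y : V} (hv : v ∉ covered F)
    (h₁ : H.Adj v x₁) (h₂ : H.Adj v x₂) (hne : x₁ ≠ x₂) (hy₁ : s(x₁, y) ∈ F)
    (hy₂ : s(x₂, y) ∈ F) : #{e ∈ F | y ∈ e} ≤ 2 := by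
  by_contra! h3
  have hnot : ∀ e ∈ F, v ∉ e := fun e he hve => hv (mem_covered.2 ⟨e, he, hve⟩)
  have hvy : v ≠ y := by rintro rfl; exact hnot _ hy₁ (by simp)
  have a₁ : H.Adj x₁ y := hF.sub _ hy₁
  have a₂ : H.Adj x₂ y := hF.sub _ hy₂
  have n1 := h₁.ne
  have n2 := h₂.ne
  have n3 := a₁.ne
  have n4 := a₂.ne
  let c : H.Walk v v := .cons h₁ (.cons a₁ (.cons a₂.symm (.cons h₂.symm .nil)))
  have hc : c.IsTrail := by
    rw [Walk.isTrail_def]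
    simp [c]
    grind
  have hmem : ∀ e, e ∈ c.edges.toFinset ↔
      e = s(v, x₁) ∨ e = s(x₁, y) ∨ e = s(y, x₂) ∨ e = s(x₂, v) := by
    intro e; simp [c]
  have hsub : ∀ e ∈ symmDiff F c.edges.toFinset, e ∈ H.edgeSet := by
    intro e he
    rcases mem_symmDiff.1 he with h | h
    exacts [hF.sub e h.1, c.edges_subset_edgeSet (List.mem_toFinset.1 h.1)]
  have hle := hF.card_covered_le _ hsub (hF.even.symmDiff hc.isEvenSet_edges)
  have hvx : ∀ x, s(v, x) ∈ c.edges.toFinset → ∀ z ∈ s(v, x),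
      z ∈ covered (symmDiff F c.edges.toFinset) := by
    intro x hx z hz
    exact mem_covered.2 ⟨_, mem_symmDiff.2 (.inr ⟨hx, fun h => hnot _ h (by simp)⟩), hz⟩
  have c₁ := hvx x₁ ((hmem _).2 (.inl rfl))
  have c₂ := hvx x₂ ((hmem _).2 (.inr (.inr (.inr Sym2.eq_swap))))
  -- The new edges at `v` cover `x₁` and `x₂`; the only other vertex to lose edges is `y`, which
  -- loses two and keeps a third.
  have hcov : insert v (covered F) ⊆ covered (symmDiff F c.edges.toFinset) := by
    refine insert_subset (c₁ v (by simp)) fun x hx => ?_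
    by_cases hx1 : x = x₁
    · exact c₁ x (by simp [hx1])
    by_cases hx2 : x = x₂
    · exact c₂ x (by simp [hx2])
    by_cases hxy : x = y
    · subst hxy
      have h4 : ∃ e ∈ ({e ∈ F | x ∈ e} : Finset (Sym2 V)), e ∉ ({s(x₁, x), s(x₂, x)} : Finset _) :=
        exists_mem_notMem_of_card_lt_card (card_le_two.trans_lt h3)
      obtain ⟨e, he, hne'⟩ := h4
      rw [mem_filter] at he
      refine mem_covered.2 ⟨e, mem_symmDiff.2 (.inl ⟨he.1, fun hh => ?_⟩), he.2⟩
      rw [hmem] at hh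
      simp only [mem_insert, mem_singleton, not_or] at hne'
      rcases hh with rfl | rfl | rfl | rfl
      · exact hnot _ he.1 (by simp)
      · exact hne'.1 rfl
      · exact hne'.2 Sym2.eq_swap
      · exact hnot _ he.1 (by simp)
    · obtain ⟨e, he, hxe⟩ := mem_covered.1 hx
      refine mem_covered.2 ⟨e, mem_symmDiff.2 (.inl ⟨he, fun hh => ?_⟩), hxe⟩
      have hxv : x ≠ v := by rintro rfl; exact hv hx
      rw [hmem] at hh
      rcases hh with rfl | rfl | rfl | rfl <;> simp_all
  have := card_le_card hcov
  rw [card_insert_of_notMem hv] at this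
  omega

/-- The covered neighbors of an uncovered vertex are saturated by a matching in `F`. -/
lemma IsOptimal.exists_injOn [Fintype V] [DecidableEq V] {H : SimpleGraph V} [DecidableRel H.Adj]
    {F : Finset (Sym2 V)} (hF : IsOptimal H F) {v : V} (hv : v ∉ covered F) :
    ∃ g : V → V, Set.InjOn g {x | x ∈ covered F ∧ H.Adj v x} ∧
      ∀ x, x ∈ covered F → H.Adj v x → s(x, g x) ∈ F := by
  let X := {x // x ∈ covered F ∧ H.Adj v x}
  let t : X → Finset V := fun x => {y | s(x.1, y) ∈ F}
  have hall : ∀ A : Finset X, #A ≤ #(A.biUnion t) := by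
    intro A
    -- Hall's condition by double counting: a covered `x` has at least two `F`-edges by parity,
    -- while each `y` is `F`-adjacent to at most two elements of `A`.
    suffices #A * 2 ≤ #(A.biUnion t) * 2 by omega
    refine card_mul_le_card_mul (fun (x : X) (y : V) => s(x.1, y) ∈ F) (fun x hx => ?_)
      (fun y hy => ?_)
    · obtain ⟨e, he, hxe⟩ := mem_covered.1 x.2.1
      have hpos : 0 < #{e ∈ F | x.1 ∈ e} := card_pos.2 ⟨e, by simp [he, hxe]⟩
      obtain ⟨m, hm⟩ := hF.even x.1
      have hle : #{e ∈ F | x.1 ∈ e} ≤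
          #((A.biUnion t).bipartiteAbove (fun (x : X) (y : V) => s(x.1, y) ∈ F) x) := by
        refine (card_le_card fun e he => ?_).trans (card_image_le (f := fun y => s(x.1, y)))
        rw [mem_filter] at he
        obtain ⟨y, rfl⟩ := Sym2.mem_iff_exists.1 he.2
        refine mem_image.2 ⟨y, (mem_bipartiteAbove _).2 ⟨mem_biUnion.2 ⟨x, hx, ?_⟩, he.1⟩, rfl⟩
        simpa [t] using he.1
      omega
    · by_contra! h3
      obtain ⟨a, ha, b, hb, hab⟩ := one_lt_card.1 (lt_trans one_lt_two h3)
      rw [mem_bipartiteBelow] at ha hb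
      have h2 := hF.card_filter_mem_le_two hv a.2.2 b.2.2 (fun h => hab (Subtype.ext h)) ha.2 hb.2
      have hle := card_le_card_of_injOn (s := A.bipartiteBelow (fun (x : X) (y : V) =>
        s(x.1, y) ∈ F) y) (t := {e ∈ F | y ∈ e}) (fun x => s(x.1, y))
        (fun x hx => by
          have hx := (mem_bipartiteBelow _).1 hx
          simp [hx.2])
        (fun x _ x' _ h => Subtype.ext (Sym2.congr_left.1 h))
      omega
  obtain ⟨f, hf, hft⟩ := (all_card_le_biUnion_card_iff_exists_injective t).1 hall
  refine ⟨fun x => if h : x ∈ covered F ∧ H.Adj v x then f ⟨x, h⟩ else x, ?_, ?_⟩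
  · intro a ha b hb hab
    simp only [Set.mem_ofPred_eq] at ha hb
    simp only [ha, hb, and_self, dite_true] at hab
    exact congrArg Subtype.val (hf hab)
  · intro x h1 h2
    have := hft ⟨x, h1, h2⟩
    simpa [t, h1, h2] using this

/-! ### Matchings and degrees in the line graph -/

/-- The edges in `M` are pairwise vertex-disjoint. -/
def IsMatchingSet (M : Finset (Sym2 V)) : Prop :=
  ∀ e ∈ M, ∀ e' ∈ M, ∀ v, v ∈ e → v ∈ e' → e = e'

lemma card_covered_le_two_mul [Fintype V] [DecidableEq V] (M : Finset (Sym2 V)) :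
    #(covered M) ≤ #M * 2 := by
  have h : covered M ⊆ M.biUnion fun e => {v | v ∈ e} := by
    intro v hv
    obtain ⟨e, he, hve⟩ := mem_covered.1 hv
    exact mem_biUnion.2 ⟨e, he, by simpa using hve⟩
  refine (card_le_card h).trans (card_biUnion_le_card_mul _ _ _ fun e _ => ?_)
  induction e with | _ x y =>
  refine (card_le_card (t := {x, y}) fun v hv => ?_).trans card_le_two
  simpa using hv

/-- If the vertices of a matching `M` induce a forest, then the sum over `M` of the degrees in the
line graph is less than the number of edges. -/
lemma IsMatchingSet.sum_card_lt [Fintype V] [DecidableEq V] {H : SimpleGraph V} [Fintype H.edgeSet]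
    [DecidableRel H.Adj] {M : Finset (Sym2 V)} (hM : IsMatchingSet M)
    (hMH : ∀ e ∈ M, e ∈ H.edgeSet) (hne : M.Nonempty) (hl : HasLeaves H (covered M)) :
    ∑ e ∈ M, #{f ∈ H.edgeFinset | f ≠ e ∧ ∃ v ∈ e, v ∈ f} < #H.edgeFinset := by
  have hcov : (covered M).Nonempty := by
    obtain ⟨e, he⟩ := hne
    induction e with | _ x y => exact ⟨x, mem_covered.2 ⟨_, he, by simp⟩⟩
  have h1 := hl.card_edgesIn_lt hcov
  have h2 := card_covered_le_two_mul M
  have hswap : ∑ e ∈ M, #{f ∈ H.edgeFinset | f ≠ e ∧ ∃ v ∈ e, v ∈ f} =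
      ∑ f ∈ H.edgeFinset, #{e ∈ M | f ≠ e ∧ ∃ v ∈ e, v ∈ f} :=
    sum_card_bipartiteAbove_eq_sum_card_bipartiteBelow (fun e f => f ≠ e ∧ ∃ v ∈ e, v ∈ f)
  have hone : ∀ x, #{e ∈ M | x ∈ e} ≤ if x ∈ covered M then 1 else 0 := by
    intro x
    split_ifs with hx
    · refine card_le_one.2 ?_
      simp only [mem_filter]
      exact fun a ha b hb => hM a ha.1 b hb.1 x ha.2 hb.2
    · rw [Nat.le_zero, card_eq_zero, filter_eq_empty_iff]
      exact fun e he hxe => hx (mem_covered.2 ⟨e, he, hxe⟩)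
  -- Summed over `f`, this bounds the degree sum plus `2 * #M` by the number of edges of `H` plus
  -- the number of edges inside `covered M`. The latter is less than `#(covered M) ≤ 2 * #M`, since
  -- `covered M` induces a forest.
  have hbound : ∀ f ∈ H.edgeFinset, #{e ∈ M | f ≠ e ∧ ∃ v ∈ e, v ∈ f} +
      2 * (if f ∈ M then 1 else 0) ≤ 1 + if (∀ v ∈ f, v ∈ covered M) then 1 else 0 := by
    intro f hf
    by_cases hfM : f ∈ M
    · have hz : #{e ∈ M | f ≠ e ∧ ∃ v ∈ e, v ∈ f} = 0 := by
        rw [card_eq_zero, filter_eq_empty_iff]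
        rintro e he ⟨hfe, v, hve, hvf⟩
        exact hfe (hM f hfM e he v hvf hve)
      have hall : ∀ v ∈ f, v ∈ covered M := fun v hv => mem_covered.2 ⟨f, hfM, hv⟩
      rw [hz, if_pos hfM, if_pos hall]
    · rw [if_neg hfM]
      induction f with | _ x y =>
      have hsub : ({e ∈ M | s(x, y) ≠ e ∧ ∃ v ∈ e, v ∈ s(x, y)} : Finset (Sym2 V)) ⊆
          {e ∈ M | x ∈ e} ∪ {e ∈ M | y ∈ e} := by
        intro e he
        simp only [mem_filter, mem_union, Sym2.mem_iff] at he ⊢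
        obtain ⟨he, -, v, hv, rfl | rfl⟩ := he
        exacts [.inl ⟨he, hv⟩, .inr ⟨he, hv⟩]
      have h3 := (card_le_card hsub).trans (card_union_le _ _)
      have hx := hone x
      have hy := hone y
      have hiff : (∀ v ∈ s(x, y), v ∈ covered M) ↔ x ∈ covered M ∧ y ∈ covered M := by simp
      rw [if_congr hiff rfl rfl]
      split_ifs at hx hy ⊢ <;> first | omega | tauto
  have hsum := sum_le_sum hbound
  rw [sum_add_distrib, sum_add_distrib, ← mul_sum, ← card_filter, ← card_filter,
    sum_const, smul_eq_mul, mul_one] at hsum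
  have h4 : H.edgeFinset.filter (· ∈ M) = M := by
    ext e
    simp only [mem_filter, mem_edgeFinset]
    exact ⟨fun h => h.2, fun h => ⟨hMH e h, h⟩⟩
  have h5 : H.edgeFinset.filter (fun f => ∀ v ∈ f, v ∈ covered M) = edgesIn H (covered M) := by
    ext e
    simp [mem_edgesIn]
  rw [h4, h5] at hsum
  omega

lemma degree_lineGraph [Fintype V] [DecidableEq V] (H : SimpleGraph V) [Fintype H.edgeSet]
    [H.lineGraph.LocallyFinite] (e : H.edgeSet) :
    H.lineGraph.degree e = #{f ∈ H.edgeFinset | f ≠ e.1 ∧ ∃ v ∈ e.1, v ∈ f} := by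
  rw [← card_neighborFinset_eq_degree, ← card_map (Function.Embedding.subtype _)]
  congr 1
  ext f
  simp only [mem_map, mem_neighborFinset, lineGraph_adj_iff_exists,
    Function.Embedding.subtype_apply, mem_filter, mem_edgeFinset, Subtype.exists,
    exists_and_right, exists_eq_right]
  constructor
  · rintro ⟨⟨hf, hne⟩, v, hv⟩
    exact ⟨hf, fun h => hne (Subtype.ext h.symm), v, hv⟩
  · rintro ⟨hf, hne, v, hv⟩
    exact ⟨⟨hf, fun h => hne (congrArg Subtype.val h).symm⟩, v, hv⟩

lemma degree_lineGraph_add_two_le [Fintype V] [DecidableEq V] (H : SimpleGraph V)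
    [DecidableRel H.Adj] [H.lineGraph.LocallyFinite] {a b : V} (h : H.Adj a b) :
    H.lineGraph.degree ⟨s(a, b), h⟩ + 2 ≤ H.degree a + H.degree b := by
  rw [degree_lineGraph]
  have hsub : ({f ∈ H.edgeFinset | f ≠ s(a, b) ∧ ∃ v ∈ s(a, b), v ∈ f} : Finset (Sym2 V)) ⊆
      image (fun x => s(a, x)) ((H.neighborFinset a).erase b) ∪
      image (fun x => s(b, x)) ((H.neighborFinset b).erase a) := by
    intro f hf
    simp only [mem_filter, mem_edgeFinset, Sym2.mem_iff] at hf
    obtain ⟨hfH, hne, v, rfl | rfl, hvf⟩ := hf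
    · obtain ⟨x, rfl⟩ := Sym2.mem_iff_exists.1 hvf
      refine mem_union_left _ (mem_image.2 ⟨x, mem_erase.2 ⟨?_, by simpa using hfH⟩, rfl⟩)
      rintro rfl
      exact hne rfl
    · obtain ⟨x, rfl⟩ := Sym2.mem_iff_exists.1 hvf
      refine mem_union_right _ (mem_image.2 ⟨x, mem_erase.2 ⟨?_, by simpa using hfH⟩, rfl⟩)
      rintro rfl
      exact hne Sym2.eq_swap
  have h1 := (card_le_card hsub).trans (card_union_le _ _)
  have h2 := card_image_le (s := (H.neighborFinset a).erase b) (f := fun x => s(a, x))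
  have h3 := card_image_le (s := (H.neighborFinset b).erase a) (f := fun x => s(b, x))
  have h4 := card_erase_add_one ((H.mem_neighborFinset a b).2 h)
  have h5 := card_erase_add_one ((H.mem_neighborFinset b a).2 h.symm)
  rw [card_neighborFinset_eq_degree] at h4 h5
  simp only at h1 ⊢
  omega

/-- A set of edges of `H`, as a set of vertices of the line graph. -/
noncomputable def toLineGraph (H : SimpleGraph V) (M : Finset (Sym2 V)) : Finset H.edgeSet :=
  open Classical in M.subtype (· ∈ H.edgeSet)

lemma mem_toLineGraph {H : SimpleGraph V} {M : Finset (Sym2 V)} {e : H.edgeSet} :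
    e ∈ toLineGraph H M ↔ e.1 ∈ M := by
  simp [toLineGraph]

lemma sum_toLineGraph {H : SimpleGraph V} {M : Finset (Sym2 V)}
    (hMH : ∀ e ∈ M, e ∈ H.edgeSet) (g : Sym2 V → ℕ) :
    ∑ e ∈ toLineGraph H M, g e = ∑ e ∈ M, g e := by
  classical
  rw [toLineGraph, sum_subtype_eq_sum_filter, filter_true_of_mem hMH]

lemma card_toLineGraph {H : SimpleGraph V} {M : Finset (Sym2 V)}
    (hMH : ∀ e ∈ M, e ∈ H.edgeSet) : #(toLineGraph H M) = #M := by
  simpa using sum_toLineGraph hMH fun _ => 1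

lemma IsMatchingSet.isIndepSet {H : SimpleGraph V} {M : Finset (Sym2 V)} (hM : IsMatchingSet M) :
    H.lineGraph.IsIndepSet (toLineGraph H M : Set H.edgeSet) := by
  intro e he f hf hne hadj
  rw [lineGraph_adj_iff_exists] at hadj
  obtain ⟨-, v, hve, hvf⟩ := hadj
  exact hne (Subtype.ext (hM e (mem_toLineGraph.1 he) f (mem_toLineGraph.1 hf) v hve hvf))

/-! ### Stars and closed trails as subgraphs -/

/-- The star with center `c` and leaves `L`. -/
def starSubgraph (H : SimpleGraph V) (c : V) (L : Finset V) : H.Subgraph where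
  verts := insert c (L : Set V)
  Adj a b := H.Adj a b ∧ ((a = c ∧ b ∈ L) ∨ (b = c ∧ a ∈ L))
  adj_sub h := h.1
  edge_vert h := by
    obtain ⟨-, ⟨rfl, -⟩ | ⟨-, h⟩⟩ := h
    · exact Set.mem_insert _ _
    · exact Set.mem_insert_of_mem _ h
  symm := ⟨fun _ _ h => ⟨h.1.symm, h.2.symm⟩⟩

lemma mem_edgeSet_starSubgraph {H : SimpleGraph V} {c : V} {L : Finset V} {e : Sym2 V} :
    e ∈ (starSubgraph H c L).edgeSet ↔ e ∈ H.edgeSet ∧ ∃ x ∈ L, e = s(c, x) := by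
  induction e with | _ a b =>
  simp only [Subgraph.mem_edgeSet, starSubgraph, mem_edgeSet, Sym2.eq_iff]
  constructor
  · rintro ⟨h, ⟨rfl, hb⟩ | ⟨rfl, ha⟩⟩
    exacts [⟨h, b, hb, .inl ⟨rfl, rfl⟩⟩, ⟨h, a, ha, .inr ⟨rfl, rfl⟩⟩]
  · rintro ⟨h, x, hx, ⟨rfl, rfl⟩ | ⟨rfl, rfl⟩⟩
    exacts [⟨h, .inl ⟨rfl, hx⟩⟩, ⟨h, .inr ⟨rfl, hx⟩⟩]

lemma isStarThree_starSubgraph {H : SimpleGraph V} {c : V} {L : Finset V}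
    (hL : ∀ x ∈ L, H.Adj c x) (h3 : 3 ≤ #L) : (starSubgraph H c L).IsStarThree := by
  refine ⟨c, L, h3, rfl, fun a b => ⟨fun h => h.2, fun h => ⟨?_, h⟩⟩⟩
  rcases h with ⟨rfl, h⟩ | ⟨rfl, h⟩
  exacts [hL _ h, (hL _ h).symm]

/-- The component of `F` that contains the edge `e`. -/
noncomputable def edgeComponent (F : Finset (Sym2 V)) (e : Sym2 V) :
    (edgeGraph F).ConnectedComponent :=
  (edgeGraph F).connectedComponentMk e.out.1

/-- The ends of an edge of `F` are adjacent in `edgeGraph F`, so the end picked by `Sym2.out` is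
immaterial. -/
lemma edgeComponent_eq {H : SimpleGraph V} {F : Finset (Sym2 V)} (hF : ∀ e ∈ F, e ∈ H.edgeSet)
    {e : Sym2 V} (he : e ∈ F) {x : V} (hx : x ∈ e) :
    edgeComponent F e = (edgeGraph F).connectedComponentMk x := by
  rw [edgeComponent, ConnectedComponent.eq]
  have h := e.out_fst_mem
  revert h
  generalize e.out.1 = a
  intro ha
  by_cases hax : a = x
  · rw [hax]
  · have : e = s(a, x) := (Sym2.mem_and_mem_iff hax).1 ⟨ha, hx⟩
    rw [this] at he
    exact (edgeGraph_adj_of_mem hF he).reachable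

lemma IsEvenSet.exists_isClosedTrail [Fintype V] [DecidableEq V] {H : SimpleGraph V}
    {F : Finset (Sym2 V)} (hE : IsEvenSet F) (hF : ∀ e ∈ F, e ∈ H.edgeSet) {e : Sym2 V}
    (he : e ∈ F) : ∃ D : H.Subgraph, D.IsClosedTrail ∧
      ∀ f, f ∈ D.edgeSet ↔ f ∈ F ∧ edgeComponent F f = edgeComponent F e := by
  induction e with | _ a b =>
  obtain ⟨u, p, hp, hpe⟩ := hE.exists_isCircuit hF he
  refine ⟨p.toSubgraph, ⟨u, p, hp, rfl⟩, fun f => ?_⟩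
  rw [Walk.mem_edges_toSubgraph, hpe, edgeComponent_eq hF he (Sym2.mem_mk_left a b)]
  refine and_congr_right fun hf => ?_
  constructor
  · rintro ⟨x, hx, hax⟩
    rw [edgeComponent_eq hF hf hx, ConnectedComponent.eq]
    exact hax.symm
  · intro h
    induction f with | _ x y =>
    rw [edgeComponent_eq hF hf (Sym2.mem_mk_left x y), ConnectedComponent.eq] at h
    exact ⟨x, Sym2.mem_mk_left x y, h.symm⟩

/-! ### Induced forests and the dominating system -/

/-- Uncovered vertices are isolated in `F`, so distinct ones are unreachable and
`IsOptimal.eq_empty` applies. -/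
lemma IsOptimal.hasLeaves_compl [Fintype V] [DecidableEq V] {H : SimpleGraph V}
    [DecidableRel H.Adj] {F : Finset (Sym2 V)} (hF : IsOptimal H F) (hH : H.CliqueFree 3) :
    HasLeaves H (covered F)ᶜ := by
  refine hasLeaves_of_forall_isEvenSet fun Z hZH hZ hZA =>
    hF.eq_empty hH (fun a ha b _ hab => .inl ?_) hZH hZ hZA
  by_contra hne
  exact mem_compl.1 ha (mem_covered_of_reachable hab hne)

/-- A matching outside the vertices covered by `F`, together with at most one edge from each
component of `F`, induces a forest. -/
lemma IsOptimal.hasLeaves_covered [Fintype V] [DecidableEq V] {H : SimpleGraph V}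
    [DecidableRel H.Adj] {F : Finset (Sym2 V)} (hF : IsOptimal H F) (hH : H.CliqueFree 3)
    {M : Finset (Sym2 V)} (hM : ∀ e ∈ M, e ∈ F ∨ ∀ v ∈ e, v ∉ covered F)
    (hinj : ∀ e ∈ M, ∀ e' ∈ M, e ∈ F → e' ∈ F → edgeComponent F e = edgeComponent F e' → e = e') :
    HasLeaves H (covered M) := by
  refine hasLeaves_of_forall_isEvenSet fun Z hZH hZ hZA =>
    hF.eq_empty hH (fun a ha b hb hab => ?_) hZH hZ hZA
  by_cases hne : a = b
  · exact .inl hne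
  right
  obtain ⟨e, he, hae⟩ := mem_covered.1 ha
  obtain ⟨e', he', hbe⟩ := mem_covered.1 hb
  have heF := (hM e he).resolve_right fun h => h a hae (mem_covered_of_reachable hab hne)
  have heF' := (hM e' he').resolve_right fun h =>
    h b hbe (mem_covered_of_reachable hab.symm (Ne.symm hne))
  have h := hinj e he e' he' heF heF' (by
    rw [edgeComponent_eq hF.sub heF hae, edgeComponent_eq hF.sub heF' hbe]
    exact ConnectedComponent.eq.2 hab)
  subst h
  rw [← (Sym2.mem_and_mem_iff hne).1 ⟨hae, hbe⟩]
  exact heF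

lemma isMatchingSet_image [DecidableEq V] {S : Finset V} {f : V → V} (hf : Set.InjOn f S)
    (hS : ∀ s ∈ S, f s ∉ S) : IsMatchingSet (S.image fun s => s(s, f s)) := by
  intro e he e' he' v hv hv'
  obtain ⟨s, hs, rfl⟩ := mem_image.1 he
  obtain ⟨t, ht, rfl⟩ := mem_image.1 he'
  rw [Sym2.mem_iff] at hv hv'
  obtain rfl : s = t := by
    rcases hv with rfl | rfl <;> rcases hv' with h | h
    · exact h
    · exact absurd (h ▸ hs) (hS t ht)
    · exact absurd (h ▸ ht) (hS s hs)
    · exact hf hs ht h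
  rfl

lemma card_image_sym2 [DecidableEq V] {S : Finset V} {f : V → V} (hS : ∀ s ∈ S, f s ∉ S) :
    #(S.image fun s => s(s, f s)) = #S := by
  refine card_image_of_injOn fun s hs t ht h => ?_
  rcases Sym2.eq_iff.1 h with ⟨h, -⟩ | ⟨-, h⟩
  · exact h
  · exact absurd (h ▸ ht) (hS s hs)

lemma IsMatchingSet.union [DecidableEq V] {M N : Finset (Sym2 V)} (hM : IsMatchingSet M)
    (hN : IsMatchingSet N) (h : ∀ e ∈ M, ∀ e' ∈ N, ∀ v ∈ e, v ∉ e') : IsMatchingSet (M ∪ N) := by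
  intro e he e' he' v hv hv'
  rcases mem_union.1 he with he | he <;> rcases mem_union.1 he' with he' | he'
  · exact hM e he e' he' v hv hv'
  · exact absurd hv' (h e he e' he' v hv)
  · exact absurd hv (h e' he' e he v hv')
  · exact hN e he e' he' v hv hv'

/-- If every edge of every matching `M` has large degree, then the vertices of a cover as in
`HasLeaves.exists_cover` have at least three neighbors outside of the cover. -/
lemma IsOptimal.three_le_card [Fintype V] [DecidableEq V] {H : SimpleGraph V}
    [DecidableRel H.Adj] {F : Finset (Sym2 V)} (hF : IsOptimal H F) (hH : H.CliqueFree 3)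
    (hdeg : ∀ M : Finset (Sym2 V), (∀ e ∈ M, e ∈ H.edgeSet) → IsMatchingSet M →
      ∀ a b, s(a, b) ∈ M → #M + 3 ≤ H.degree a + H.degree b)
    {S : Finset V} (hS : S ⊆ (covered F)ᶜ) {f : V → V} (hf : Set.InjOn f S)
    (hSf : ∀ s ∈ S, f s ∈ (covered F)ᶜ ∧ f s ∉ S ∧ H.Adj s (f s))
    (hc : ∀ a ∈ (covered F)ᶜ, ∀ b ∈ (covered F)ᶜ, H.Adj a b → a ∈ S ∨ b ∈ S)
    {s : V} (hs : s ∈ S) : 3 ≤ #{x ∈ H.neighborFinset s | x ∉ S} := by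
  obtain ⟨hv, hvS, hsv⟩ := hSf s hs
  rw [mem_compl] at hv
  obtain ⟨g, hg, hgF⟩ := hF.exists_injOn hv
  let X : Finset V := {x ∈ covered F | H.Adj (f s) x}
  have hX : ∀ x ∈ X, x ∈ covered F ∧ H.Adj (f s) x := fun x hx => mem_filter.1 hx
  have hgX : ∀ x ∈ X, g x ∉ X := by
    intro x hx hgx
    have h1 := hX x hx
    exact hH.not_adj_of_adj_adj h1.2 (hF.sub _ (hgF x h1.1 h1.2)) (hX _ hgx).2
  have hfS : ∀ s ∈ S, f s ∉ S := fun s hs => (hSf s hs).2.1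
  have hMX : IsMatchingSet (X.image fun x => s(x, g x)) :=
    isMatchingSet_image (fun a ha b hb hab => hg (hX a ha) (hX b hb) hab) hgX
  have hsep : ∀ e ∈ S.image (fun s => s(s, f s)), ∀ e' ∈ X.image (fun x => s(x, g x)),
      ∀ v ∈ e, v ∉ e' := by
    intro e he e' he' v hve hve'
    obtain ⟨t, ht, rfl⟩ := mem_image.1 he
    obtain ⟨x, hx, rfl⟩ := mem_image.1 he'
    have h1 : v ∈ covered F := mem_covered.2 ⟨_, hgF x (hX x hx).1 (hX x hx).2, hve'⟩
    rcases Sym2.mem_iff.1 hve with rfl | rfl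
    · exact mem_compl.1 (hS ht) h1
    · exact mem_compl.1 (hSf t ht).1 h1
  have hM := (isMatchingSet_image hf hfS).union hMX hsep
  have hcard : #(S.image (fun s => s(s, f s)) ∪ X.image (fun x => s(x, g x))) = #S + #X := by
    rw [card_union_of_disjoint, card_image_sym2 hfS, card_image_sym2 hgX]
    rw [Finset.disjoint_left]
    intro e he he'
    induction e with | _ a b => exact hsep _ he _ he' a (by simp) (by simp)
  -- The matching has `#S + #X` edges, so `#S + #X + 3 ≤ d(s) + d(f s)`. Neighbors of `f s` lie in
  -- `X` or `S`, and by triangle-freeness `s` and `f s` have disjoint neighborhoods in `S`;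
  -- subtracting leaves three neighbors of `s` outside `S`.
  have h1 := hdeg _ (fun e he => ?_) hM s (f s)
    (mem_union_left _ (mem_image.2 ⟨s, hs, rfl⟩))
  · rw [hcard] at h1
    have h2 : H.neighborFinset (f s) ⊆ X ∪ {x ∈ S | H.Adj (f s) x} := by
      intro x hx
      rw [mem_neighborFinset] at hx
      by_cases hxF : x ∈ covered F
      · exact mem_union_left _ (mem_filter.2 ⟨hxF, hx⟩)
      · exact mem_union_right _ (mem_filter.2
          ⟨(hc _ (mem_compl.2 hv) x (mem_compl.2 hxF) hx).resolve_left hvS, hx⟩)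
    have h3 := (card_le_card h2).trans (card_union_le _ _)
    have h4 : #{x ∈ S | H.Adj (f s) x} + #{x ∈ S | H.Adj s x} ≤ #S := by
      rw [← card_union_of_disjoint]
      · exact card_le_card (union_subset (filter_subset _ _) (filter_subset _ _))
      · rw [Finset.disjoint_left]
        intro x hx hx'
        exact hH.not_adj_of_adj_adj hsv (mem_filter.1 hx).2 (mem_filter.1 hx').2
    have h5 := card_filter_add_card_filter_not (s := H.neighborFinset s) (fun x => x ∈ S)
    have h6 : {x ∈ H.neighborFinset s | x ∈ S} = {x ∈ S | H.Adj s x} := by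
      ext x; simp [and_comm]
    rw [h6, card_neighborFinset_eq_degree] at h5
    rw [card_neighborFinset_eq_degree] at h3
    omega
  · rcases mem_union.1 he with he | he
    · obtain ⟨t, ht, rfl⟩ := mem_image.1 he
      exact (hSf t ht).2.2
    · obtain ⟨x, hx, rfl⟩ := mem_image.1 he
      exact hF.sub _ (hgF x (hX x hx).1 (hX x hx).2)

/-- The closed trails through representatives `E` of the components of an even set `F`, together
with stars at the vertices of a cover of the remaining vertices, form a dominating system. -/
lemma IsEvenSet.exists_isDominatingSystem [Fintype V] [DecidableEq V] {H : SimpleGraph V}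
    [DecidableRel H.Adj] {F E : Finset (Sym2 V)} (hE : IsEvenSet F)
    (hF : ∀ e ∈ F, e ∈ H.edgeSet) (hEF : E ⊆ F)
    (hinj : Set.InjOn (edgeComponent F) E)
    (hrep : ∀ e ∈ F, ∃ e' ∈ E, edgeComponent F e' = edgeComponent F e)
    {S : Finset V} (hS : S ⊆ (covered F)ᶜ)
    (hc : ∀ a ∈ (covered F)ᶜ, ∀ b ∈ (covered F)ᶜ, H.Adj a b → a ∈ S ∨ b ∈ S)
    (h3 : ∀ s ∈ S, 3 ≤ #{x ∈ H.neighborFinset s | x ∉ S}) :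
    ∃ 𝒟 : Finset H.Subgraph, H.IsDominatingSystem 𝒟 ∧ #𝒟 ≤ #S + #E := by
  classical
  have hT : ∀ e ∈ E, ∃ D : H.Subgraph, D.IsClosedTrail ∧
      ∀ f, f ∈ D.edgeSet ↔ f ∈ F ∧ edgeComponent F f = edgeComponent F e :=
    fun e he => hE.exists_isClosedTrail hF (hEF he)
  choose! T hTc hTe using hT
  -- An arbitrary linear order on the vertices: an edge inside `S` goes to the star of its smaller
  -- end only, which keeps the stars edge-disjoint.
  let ι := Fintype.equivFin V
  let L : V → Finset V := fun s => {x ∈ H.neighborFinset s | x ∉ S ∨ ι s < ι x}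
  have hL : ∀ s, ∀ x ∈ L s, H.Adj s x ∧ (x ∉ S ∨ ι s < ι x) := fun s x hx => by
    simpa [L] using hx
  let St : V → H.Subgraph := fun s => starSubgraph H s (L s)
  have hSt : ∀ s e, e ∈ (St s).edgeSet ↔ e ∈ H.edgeSet ∧ ∃ x ∈ L s, e = s(s, x) :=
    fun s e => mem_edgeSet_starSubgraph
  have hstar : ∀ s ∈ S, (St s).IsStarThree := by
    intro s hs
    refine isStarThree_starSubgraph (fun x hx => (hL s x hx).1) ((h3 s hs).trans ?_)
    refine card_le_card fun x hx => ?_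
    rw [mem_filter] at hx ⊢
    exact ⟨hx.1, .inl hx.2⟩
  have hTS : ∀ e ∈ E, ∀ s ∈ S, Disjoint (T e).edgeSet (St s).edgeSet := by
    intro e he s hs
    rw [Set.disjoint_left]
    intro f hf hf'
    obtain ⟨-, x, -, rfl⟩ := (hSt _ _).1 hf'
    exact mem_compl.1 (hS hs) (mem_covered.2 ⟨_, ((hTe e he _).1 hf).1, by simp⟩)
  have hdom : ∀ e ∈ H.edgeSet, (∃ v ∈ e, v ∈ covered F) →
      ∃ e' ∈ E, ∃ v ∈ e, v ∈ (T e').verts := by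
    rintro e - ⟨v, hv, hvF⟩
    obtain ⟨e₁, he₁, hv₁⟩ := mem_covered.1 hvF
    obtain ⟨e', he', hee⟩ := hrep e₁ he₁
    exact ⟨e', he', v, hv, Subgraph.mem_verts_of_mem_edge ((hTe e' he' e₁).2 ⟨he₁, hee.symm⟩) hv₁⟩
  refine ⟨S.image St ∪ E.image T, ⟨?_, ?_, ?_⟩,
    (card_union_le _ _).trans (add_le_add card_image_le card_image_le)⟩
  · intro D hD D' hD' hne
    simp only [mem_union, mem_image] at hD hD'
    rcases hD with ⟨s, hs, rfl⟩ | ⟨e, he, rfl⟩ <;> rcases hD' with ⟨t, ht, rfl⟩ | ⟨e', he', rfl⟩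
    · rw [Set.disjoint_left]
      intro f hf hf'
      obtain ⟨-, x, hx, rfl⟩ := (hSt _ _).1 hf
      obtain ⟨-, y, hy, hxy⟩ := (hSt _ _).1 hf'
      rcases Sym2.eq_iff.1 hxy with ⟨rfl, -⟩ | ⟨rfl, rfl⟩
      · exact hne rfl
      · have h1 := (hL _ _ hx).2.resolve_left (fun h => h ht)
        have h2 := (hL _ _ hy).2.resolve_left (fun h => h hs)
        exact lt_asymm h1 h2
    · exact (hTS e' he' s hs).symm
    · exact hTS e he t ht
    · rw [Set.disjoint_left]
      intro f hf hf'
      have h1 := ((hTe e he f).1 hf).2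
      have h2 := ((hTe e' he' f).1 hf').2
      exact hne (congrArg T (hinj he he' (h1.symm.trans h2)))
  · intro D hD
    simp only [mem_union, mem_image] at hD
    rcases hD with ⟨s, hs, rfl⟩ | ⟨e, he, rfl⟩
    exacts [.inr (hstar s hs), .inl (hTc e he)]
  · intro e he hnot
    by_cases hcov : ∃ v ∈ e, v ∈ covered F
    · obtain ⟨e', he', h⟩ := hdom e he hcov
      exact ⟨T e', mem_union_right _ (mem_image_of_mem _ he'), hTc e' he', h⟩
    · exfalso
      have hnS : ∀ s ∈ S, ∀ x, H.Adj s x → s(s, x) = e → x ∈ S ∧ ¬ ι s < ι x := by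
        intro s hs x hsx hse
        by_contra hcon
        refine hnot (St s) (mem_union_left _ (mem_image_of_mem _ hs))
          ((hSt _ _).2 ⟨he, x, ?_, hse.symm⟩)
        simp only [L, mem_filter, mem_neighborFinset]
        exact ⟨hsx, by tauto⟩
      have hall : ∀ s ∈ S, ∀ x, H.Adj s x → s(s, x) = e → False := by
        intro s hs x hsx hse
        obtain ⟨hx, h1⟩ := hnS s hs x hsx hse
        obtain ⟨-, h2⟩ := hnS x hx s hsx.symm (Sym2.eq_swap.trans hse)
        exact hsx.ne (ι.injective (le_antisymm (not_lt.1 h2) (not_lt.1 h1)))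
      induction e with | _ a b =>
      push Not at hcov
      rcases hc a (mem_compl.2 (hcov a (by simp))) b (mem_compl.2 (hcov b (by simp))) he with h | h
      · exact hall a h b he rfl
      · exact hall b h a he.symm Sym2.eq_swap

end SimpleGraph

/-! ### The main theorem -/

open SimpleGraph Finset in
theorem theorem2p5 {V : Type*} [Fintype V] (H : SimpleGraph V) (k : ℕ) (hk : 1 ≤ k)
    [Fintype H.edgeSet] [H.lineGraph.LocallyFinite]
    (hH : H.CliqueFree 3)
    (hσ : (Fintype.card H.edgeSet : ℕ∞) ≤ H.lineGraph.minDegreeSum (k + 1))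
    (hδ : ∀ I : Finset H.edgeSet, H.lineGraph.IsIndepSet (I : Set H.edgeSet) →
      (I.card : ℕ∞) + 1 ≤ H.lineGraph.minDegreeOn I) :
    ∃ 𝒟 : Finset H.Subgraph, H.IsDominatingSystem 𝒟 ∧ 𝒟.card ≤ k := by
  classical
  -- The constant 3 is the 1 of `hδ` plus 2, since `d(a) + d(b)` counts the edge `s(a, b)` twice.
  have hdeg : ∀ M : Finset (Sym2 V), (∀ e ∈ M, e ∈ H.edgeSet) → IsMatchingSet M →
      ∀ a b, s(a, b) ∈ M → #M + 3 ≤ H.degree a + H.degree b := by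
    intro M hMH hM a b hab
    have h1 := (hδ (toLineGraph H M) hM.isIndepSet).trans
      (iInf_le _ ⟨⟨s(a, b), hMH _ hab⟩, mem_toLineGraph.2 hab⟩)
    rw [card_toLineGraph hMH] at h1
    have h2 := degree_lineGraph_add_two_le H (a := a) (b := b) (hMH _ hab)
    have h3 : #M + 1 ≤ H.lineGraph.degree ⟨s(a, b), hMH _ hab⟩ := by exact_mod_cast h1
    omega
  obtain ⟨F, hF⟩ := exists_isOptimal H
  obtain ⟨S, hS, f, hf, hSf, hc⟩ := (hF.hasLeaves_compl hH).exists_cover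
  -- `E` consists of one edge from each component of `F` that has an edge.
  obtain ⟨E, hEF, hinj, himg⟩ := exists_subset_injOn_image_eq_of_surjOn (f := edgeComponent F)
    (F : Set (Sym2 V)) (F.image (edgeComponent F)) (by
      intro c hc
      simpa using hc)
  have hEF' : E ⊆ F := by exact_mod_cast hEF
  have hrep : ∀ e ∈ F, ∃ e' ∈ E, edgeComponent F e' = edgeComponent F e := by
    intro e he
    have := mem_image_of_mem (edgeComponent F) he
    rwa [← himg, mem_image] at this
  obtain ⟨𝒟, h𝒟, hcard⟩ := hF.even.exists_isDominatingSystem hF.sub hEF' hinj hrep hS hc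
    fun s hs => hF.three_le_card hH hdeg hS hf hSf hc hs
  refine ⟨𝒟, h𝒟, hcard.trans ?_⟩
  by_contra! hlt
  have hfS : ∀ s ∈ S, f s ∉ S := fun s hs => (hSf s hs).2.1
  have hE : IsMatchingSet E := by
    intro e he e' he' v hv hv'
    refine hinj he he' ?_
    rw [edgeComponent_eq hF.sub (hEF' he) hv, edgeComponent_eq hF.sub (hEF' he') hv']
  have hout : ∀ e ∈ S.image (fun s => s(s, f s)), ∀ v ∈ e, v ∉ covered F := by
    intro e he v hv
    obtain ⟨s, hs, rfl⟩ := mem_image.1 he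
    rcases Sym2.mem_iff.1 hv with rfl | rfl
    exacts [mem_compl.1 (hS hs), mem_compl.1 (hSf s hs).1]
  have hsep : ∀ e ∈ S.image (fun s => s(s, f s)), ∀ e' ∈ E, ∀ v ∈ e, v ∉ e' :=
    fun e he e' he' v hv hv' => hout e he v hv (mem_covered.2 ⟨e', hEF' he', hv'⟩)
  have hM := (isMatchingSet_image hf hfS).union hE hsep
  have hcardM : #(S.image (fun s => s(s, f s)) ∪ E) = #S + #E := by
    rw [card_union_of_disjoint, card_image_sym2 hfS]
    rw [Finset.disjoint_left]
    intro e he he'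
    induction e with | _ a b => exact hsep _ he _ he' a (by simp) (by simp)
  -- Only `k + 1` edges are kept, the size to which `hσ` applies; a subset of the matching still
  -- meets each component of `F` in at most one edge.
  obtain ⟨M, hMsub, hMcard⟩ := exists_subset_card_eq (n := k + 1) (hcardM ▸ hlt)
  have hMH : ∀ e ∈ M, e ∈ H.edgeSet := by
    intro e he
    rcases mem_union.1 (hMsub he) with h | h
    · obtain ⟨s, hs, rfl⟩ := mem_image.1 h
      exact (hSf s hs).2.2
    · exact hF.sub e (hEF' h)
  have hMm : IsMatchingSet M := fun e he e' he' => hM e (hMsub he) e' (hMsub he')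
  have hor : ∀ e ∈ M, e ∈ E ∨ ∀ v ∈ e, v ∉ covered F := fun e he =>
    (mem_union.1 (hMsub he)).elim (fun h => .inr (hout e h)) .inl
  have hEM : ∀ e ∈ M, e ∈ F → e ∈ E := by
    intro e he heF
    refine (hor e he).resolve_right fun h => ?_
    induction e with | _ a b => exact h a (by simp) (mem_covered.2 ⟨_, heF, by simp⟩)
  have hleaf := hF.hasLeaves_covered hH (M := M) (fun e he => (hor e he).imp_left (hEF' ·))
    (fun e he e' he' heF heF' h => hinj (hEM e he heF) (hEM e' he' heF') h)
  have hlt' := hMm.sum_card_lt hMH (card_pos.1 (by omega)) hleaf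
  have h1 := hσ.trans (iInf_le _
    ⟨toLineGraph H M, hMm.isIndepSet, (card_toLineGraph hMH).trans hMcard⟩)
  have h2 : Fintype.card H.edgeSet ≤ ∑ e ∈ toLineGraph H M, H.lineGraph.degree e := by
    exact_mod_cast h1
  simp only [degree_lineGraph] at h2
  rw [sum_toLineGraph hMH (fun e => #{f ∈ H.edgeFinset | f ≠ e ∧ ∃ v ∈ e, v ∈ f}),
    ← edgeFinset_card] at h2
  omega
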